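/- Let $G$ be a finite simple graph. For a vertex $x$, write $N[x]$ for its closed neighbourhood ($x$ together with all its neighbours). Let $\mathrm{Ind}(G)$ be the independence complex of $G$, i.e. the simplicial complex whose vertices are the vertices of $G$ and whose simplices are the independent sets of $G$, and let $\Sigma$ denote unreduced suspension (with $\Sigma\emptyset=S^0$). Let $v$ be a vertex of $G$ of degree $2$ with neighbours $u$ and $w$ such that $N[u]\cap N[w]=\{v\}$. Let $G'$ be the graph obtained from $G$ by deleting the vertices $u,v,w$ and adding all edges $xy$ (not already present) with $x\in N[u]\setminus\{u,v\}$ and $y\in N[w]\setminus\{v,w\}$. Then there is a homotopy equivalence $$\mathrm{Ind}(G)\simeq\Sigma\,\mathrm{Ind}(G').$$ -/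

import Mathlib

open scoped ContinuousMap

/-- The independence complex `Ind(G)`: its faces are the nonempty finite independent sets of `G`. -/
def SimpleGraph.indComplex {V : Type*} (G : SimpleGraph V) : AbstractSimplicialComplex V where
  faces := {s | s.Nonempty ∧ G.IsIndepSet (s : Set V)}
  isRelLowerSet_faces := fun _ hs =>
    ⟨hs.1, fun _ hts ht => ⟨ht, hs.2.mono (Finset.coe_subset.mpr hts)⟩⟩
  singleton_mem := fun v => ⟨Finset.singleton_nonempty v, by simp [SimpleGraph.IsIndepSet]⟩

/-- The geometric realization of a simplicial complex on a finite vertex set, in barycentric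
coordinates: the points of `ℝ^V` with nonnegative coordinates which vanish outside some face and
sum to `1` over it. It carries the subspace topology of `ℝ^V`. For the complex without vertices
this is the empty space. -/
def AbstractSimplicialComplex.realization {V : Type*} [Finite V]
    (K : AbstractSimplicialComplex V) : Set (V → ℝ) :=
  {x | (∀ i, 0 ≤ x i) ∧ ∃ s ∈ K.faces, (∀ i, i ∉ s → x i = 0) ∧ ∑ i ∈ s, x i = 1}

/-- The identifications defining the unreduced suspension: the bottom `X × {0}` of the cylinder is
glued to the first cone point and the top `X × {1}` to the second. -/
inductive UnreducedSuspension.Glue (X : Type*) :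
    Bool ⊕ (X × unitInterval) → Bool ⊕ (X × unitInterval) → Prop
  | bot (x : X) : UnreducedSuspension.Glue X (Sum.inr (x, 0)) (Sum.inl false)
  | top (x : X) : UnreducedSuspension.Glue X (Sum.inr (x, 1)) (Sum.inl true)

/-- The unreduced suspension `Σ X`: the quotient of the disjoint union of two points and
`X × [0,1]`, with the quotient topology. In particular `Σ ∅ = S⁰`. -/
def UnreducedSuspension (X : Type*) : Type _ := Quot (UnreducedSuspension.Glue X)

instance UnreducedSuspension.instTopologicalSpace (X : Type*) [TopologicalSpace X] :
    TopologicalSpace (UnreducedSuspension X) :=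
  inferInstanceAs (TopologicalSpace (Quot (UnreducedSuspension.Glue X)))

/-- The closed neighbourhood `N[x]`. -/
def SimpleGraph.closedNbhd {V : Type*} (G : SimpleGraph V) (x : V) : Set V :=
  insert x (G.neighborSet x)

/-- The graph obtained from `G` by removing the vertices `u`, `v`, `w` and joining each remaining
vertex of `N[u]` to each (different) remaining vertex of `N[w]`; all edges of `G` between
remaining vertices are kept. -/
def SimpleGraph.removeAndSpan {V : Type*} (G : SimpleGraph V) (u v w : V) :
    SimpleGraph ↥({u, v, w}ᶜ : Set V) :=
  G.induce ({u, v, w}ᶜ : Set V) ⊔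
    SimpleGraph.fromRel fun x y => (x : V) ∈ G.closedNbhd u ∧ (y : V) ∈ G.closedNbhd w

/-! Points of Ind(G) are probability weights x with x i * x j = 0 on edges. Points of the suspension
are pairs (z, t) with z of mass 1 - |t|, supported off u, v, w and orthogonal along the edges of G'.
Let A and B be the neighbours of u and w other than v. The hypothesis on N[u] and N[w] makes A and B
disjoint and u, w nonadjacent.

An independent set of G' is independent in G and misses A or B. It can therefore be extended by v,
which gives the upper cone, and by u or w, which gives the lower cone. Accordingly `ofSuspension`
puts mass t at v when t ≥ 0. When t < 0 it truncates z on A ∪ B at c = -t and divides c plus the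
removed mass between u and w by `sideMass`. In the other direction, `toSuspension` truncates at the
smaller of x(A) and x(B), which empties A or B, and records all lost mass in t, with sign + for v
and the truncation, and - for u and w.

All homotopies are straight segments. A segment stays inside as soon as its endpoints have vanishing
cross products along edges and, in the suspension, heights of the same sign. Only the segment from x
to its image under the round trip on Ind(G) can fail: that image may charge w while x charges B. The
intermediate map `pushMass` repairs this. -/

theorem ContinuousMap.Homotopic.of_segment_subset {E Y : Type*} [AddCommGroup E] [Module ℝ E]
    [TopologicalSpace E] [IsTopologicalAddGroup E] [ContinuousSMul ℝ E] [TopologicalSpace Y]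
    {X : Set E} (f g : C(Y, X)) (h : ∀ y, segment ℝ (f y : E) (g y) ⊆ X) :
    ContinuousMap.Homotopic f g := by
  refine ⟨⟨⟨fun p => ⟨(1 - (p.1 : ℝ)) • (f p.2 : E) + (p.1 : ℝ) • (g p.2 : E), h p.2 ?_⟩, ?_⟩,
    ?_, ?_⟩⟩
  · exact ⟨1 - p.1, p.1, by linarith [p.1.2.2], p.1.2.1, by ring, rfl⟩
  · fun_prop
  · intro y
    ext
    simp
  · intro y
    ext
    simp

/-! ### Weight models of Ind(G) and of the suspension -/

section Weights

variable {V : Type*} [Fintype V]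

/-- Probability weights on `V` with no two related points in the support. -/
def independentWeights (r : V → V → Prop) : Set (V → ℝ) :=
  {x | (∀ i, 0 ≤ x i) ∧ ∑ i, x i = 1 ∧ ∀ i j, r i j → x i * x j = 0}

/-- A model of the suspension of the space of independent weights that vanish on `N`: the
suspension coordinate `t` runs from `-1` to `1`, and the weights have total mass `1 - |t|`. -/
def independentSuspension (r : V → V → Prop) (N : Set V) : Set ((V → ℝ) × ℝ) :=
  {p | (∀ i, 0 ≤ p.1 i) ∧ (∀ i ∈ N, p.1 i = 0) ∧ (∑ i, p.1 i) + |p.2| = 1 ∧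
    ∀ i j, r i j → p.1 i * p.1 j = 0}

theorem mul_combination_eq_zero {a b x y x' y' : ℝ} (h : x * y = 0) (h₁ : x * y' = 0)
    (h₂ : x' * y = 0) (h' : x' * y' = 0) : (a * x + b * x') * (a * y + b * y') = 0 := by
  linear_combination a * a * h + a * b * h₁ + a * b * h₂ + b * b * h'

theorem segment_subset_independentWeights {r : V → V → Prop} (hr : ∀ i j, r i j → r j i)
    {x y : V → ℝ} (hx : x ∈ independentWeights r) (hy : y ∈ independentWeights r)
    (hxy : ∀ i j, r i j → x i * y j = 0) : segment ℝ x y ⊆ independentWeights r := by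
  rintro _ ⟨a, b, ha, hb, hab, rfl⟩
  refine ⟨fun i => ?_, ?_, fun i j hij => ?_⟩
  · have := hx.1 i
    have := hy.1 i
    simp only [Pi.add_apply, Pi.smul_apply, smul_eq_mul]
    positivity
  · simp [Finset.sum_add_distrib, ← Finset.mul_sum, hx.2.1, hy.2.1, hab]
  · exact mul_combination_eq_zero (hx.2.2 i j hij) (hxy i j hij)
      (by rw [mul_comm]; exact hxy j i (hr i j hij)) (hy.2.2 i j hij)

/-- The condition `ht` makes |·| additive along the segment, so the mass equation, linear on each
half, is preserved. -/
theorem segment_subset_independentSuspension {r : V → V → Prop} {N : Set V}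
    (hr : ∀ i j, r i j → r j i) {x y : (V → ℝ) × ℝ} (hx : x ∈ independentSuspension r N)
    (hy : y ∈ independentSuspension r N) (hxy : ∀ i j, r i j → x.1 i * y.1 j = 0)
    (ht : 0 ≤ x.2 * y.2) : segment ℝ x y ⊆ independentSuspension r N := by
  rintro _ ⟨a, b, ha, hb, hab, rfl⟩
  refine ⟨fun i => ?_, fun i hi => ?_, ?_, fun i j hij => ?_⟩
  · have := hx.1 i
    have := hy.1 i
    simp only [Prod.fst_add, Prod.smul_fst, Pi.add_apply, Pi.smul_apply, smul_eq_mul]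
    positivity
  · simp [hx.2.1 i hi, hy.2.1 i hi]
  · have habs : |a * x.2 + b * y.2| = a * |x.2| + b * |y.2| := by
      rw [(abs_add_eq_add_abs_iff _ _).2, abs_mul, abs_mul, abs_of_nonneg ha, abs_of_nonneg hb]
      rcases mul_nonneg_iff.1 ht with h | h
      · exact .inl ⟨mul_nonneg ha h.1, mul_nonneg hb h.2⟩
      · exact .inr ⟨mul_nonpos_of_nonneg_of_nonpos ha h.1,
          mul_nonpos_of_nonneg_of_nonpos hb h.2⟩
    have h₁ := hx.2.2.1
    have h₂ := hy.2.2.1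
    simp only [Prod.fst_add, Prod.smul_fst, Pi.add_apply, Pi.smul_apply, smul_eq_mul,
      Prod.snd_add, Prod.smul_snd, Finset.sum_add_distrib, ← Finset.mul_sum, habs]
    linear_combination a * h₁ + b * h₂ + hab
  · exact mul_combination_eq_zero (hx.2.2.2 i j hij) (hxy i j hij)
      (by rw [mul_comm]; exact hxy j i (hr i j hij)) (hy.2.2.2 i j hij)

theorem isCompact_independentWeights (r : V → V → Prop) : IsCompact (independentWeights r) := by
  refine IsCompact.of_isClosed_subset (isCompact_Icc (a := (0 : V → ℝ)) (b := 1)) ?_ ?_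
  · simp only [independentWeights, Set.ofPred_and, Set.ofPred_forall]
    refine (isClosed_iInter fun i => isClosed_le (by fun_prop) (by fun_prop)).inter
      ((isClosed_eq (by fun_prop) (by fun_prop)).inter
      (isClosed_iInter fun i => isClosed_iInter fun j => isClosed_iInter fun _ =>
        isClosed_eq (by fun_prop) (by fun_prop)))
  · intro x hx
    refine ⟨hx.1, fun i => ?_⟩
    rw [Pi.one_apply, ← hx.2.1]
    exact Finset.single_le_sum (fun j _ => hx.1 j) (Finset.mem_univ i)

theorem SimpleGraph.realization_indComplex (G : SimpleGraph V) :
    G.indComplex.realization = independentWeights G.Adj := by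
  classical
  ext x
  constructor
  · rintro ⟨h0, s, hs, hx, hsum⟩
    refine ⟨h0, ?_, fun i j hij => ?_⟩
    · rw [← hsum]
      exact (Finset.sum_subset (Finset.subset_univ s) fun i _ hi => hx i hi).symm
    · by_contra h
      have hi : i ∈ s := by_contra fun hi => h (by rw [hx i hi, zero_mul])
      have hj : j ∈ s := by_contra fun hj => h (by rw [hx j hj, mul_zero])
      exact hs.2 hi hj hij.ne hij
  · rintro ⟨h0, hsum, hx⟩
    have hs : ∑ i with x i ≠ 0, x i = 1 := by rw [Finset.sum_filter_ne_zero, hsum]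
    refine ⟨h0, Finset.univ.filter fun i => x i ≠ 0, ⟨?_, fun i hi j hj _ hij => ?_⟩,
      fun i hi => by simpa using hi, hs⟩
    · by_contra h
      rw [Finset.not_nonempty_iff_eq_empty] at h
      rw [h] at hs
      simp at hs
    · simp only [Finset.coe_filter, Finset.mem_univ, true_and, Set.mem_ofPred_eq] at hi hj
      exact mul_ne_zero hi hj (hx i j hij)

end Weights

/-! ### The quotient suspension is homeomorphic to the model -/

section Suspension

variable {V : Type*}

open Classical in
/-- Extension by zero of a function on the complement of `N`. -/
noncomputable def extendZero (N : Set V) (y : ↥Nᶜ → ℝ) (i : V) : ℝ :=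
  if h : i ∈ Nᶜ then y ⟨i, h⟩ else 0

theorem extendZero_coe {N : Set V} (y : ↥Nᶜ → ℝ) (i : ↥Nᶜ) : extendZero N y i = y i := by
  simp [extendZero]

theorem extendZero_of_mem {N : Set V} (y : ↥Nᶜ → ℝ) {i : V} (hi : i ∈ N) :
    extendZero N y i = 0 := by
  simp [extendZero, hi]

theorem continuous_extendZero (N : Set V) : Continuous (extendZero N) := by
  refine continuous_pi fun i => ?_
  by_cases hi : i ∈ N
  · simp only [extendZero_of_mem _ hi]
    exact continuous_const
  · simp only [extendZero, Set.mem_compl_iff, hi, not_false_eq_true, dite_true]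
    fun_prop

theorem sum_extendZero [Fintype V] {N : Set V} [Fintype ↥Nᶜ] (y : ↥Nᶜ → ℝ) :
    ∑ i, extendZero N y i = ∑ i, y i := by
  classical
  have hsub : ∑ i, extendZero N y i = ∑ i ∈ Finset.univ.filter (· ∈ Nᶜ), extendZero N y i := by
    refine (Finset.sum_subset (Finset.subset_univ _) fun i _ hi => ?_).symm
    exact extendZero_of_mem y (by simpa using hi)
  rw [hsub, Finset.sum_subtype (p := (· ∈ Nᶜ)) _ (by simp)]
  exact Finset.sum_congr rfl fun i _ => extendZero_coe y i

variable {N : Set V} [Fintype ↥Nᶜ] {r : V → V → Prop}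
  {r' : ↥Nᶜ → ↥Nᶜ → Prop}

/-- The comparison map from two points and a cylinder to the model of the suspension. -/
noncomputable def cylinderMap (r' : ↥Nᶜ → ↥Nᶜ → Prop) :
    Bool ⊕ (independentWeights r' × unitInterval) → (V → ℝ) × ℝ :=
  Sum.elim (fun b => (0, if b then 1 else -1)) fun p =>
    ((1 - |2 * (p.2 : ℝ) - 1|) • extendZero N p.1, 2 * (p.2 : ℝ) - 1)

theorem continuous_cylinderMap : Continuous (cylinderMap r') := by
  refine continuous_sum_dom.2 ⟨continuous_of_discreteTopology, ?_⟩
  have := continuous_extendZero N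
  change Continuous fun p : independentWeights r' × unitInterval =>
    ((1 - |2 * (p.2 : ℝ) - 1|) • extendZero N p.1, 2 * (p.2 : ℝ) - 1)
  fun_prop

theorem abs_two_mul_sub_one_le (s : unitInterval) : |2 * (s : ℝ) - 1| ≤ 1 :=
  abs_le.2 ⟨by linarith [s.2.1], by linarith [s.2.2]⟩

theorem abs_two_mul_sub_one_lt {s : unitInterval} (h₀ : s ≠ 0) (h₁ : s ≠ 1) :
    |2 * (s : ℝ) - 1| < 1 := by
  have h₀ : (0 : ℝ) < s := unitInterval.pos_iff_ne_zero.2 h₀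
  have h₁ : (s : ℝ) < 1 := unitInterval.lt_one_iff_ne_one.2 h₁
  exact abs_lt.2 ⟨by linarith, by linarith⟩

theorem cylinderMap_mem [Fintype V] (hr : ∀ i j : ↥Nᶜ, r' i j ↔ r i j)
    (p : Bool ⊕ (independentWeights r' × unitInterval)) :
    cylinderMap r' p ∈ independentSuspension r N := by
  rcases p with b | ⟨⟨y, hy⟩, s⟩
  · cases b <;> simp [cylinderMap, independentSuspension]
  · have hs := abs_two_mul_sub_one_le s
    refine ⟨fun i => mul_nonneg (by linarith) ?_, fun i hi => ?_, ?_, fun i j hij => ?_⟩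
    · by_cases hi : i ∈ N
      · exact (extendZero_of_mem y hi).ge
      · exact (extendZero_coe y ⟨i, hi⟩).ge.trans' (hy.1 _)
    · simp [cylinderMap, extendZero_of_mem y hi]
    · simp [cylinderMap, ← Finset.mul_sum, sum_extendZero, hy.2.1]
    · by_cases hi : i ∈ N
      · simp [cylinderMap, extendZero_of_mem y hi]
      by_cases hj : j ∈ N
      · simp [cylinderMap, extendZero_of_mem y hj]
      have h := hy.2.2 ⟨i, hi⟩ ⟨j, hj⟩ ((hr _ _).2 hij)
      have hi' := extendZero_coe y ⟨i, hi⟩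
      have hj' := extendZero_coe y ⟨j, hj⟩
      dsimp only at hi' hj'
      simp only [cylinderMap, Sum.elim_inr, Pi.smul_apply, smul_eq_mul, hi', hj']
      linear_combination (1 - |2 * (s : ℝ) - 1|) ^ 2 * h

theorem cylinderMap_eq_of_glue {p q : Bool ⊕ (independentWeights r' × unitInterval)}
    (h : UnreducedSuspension.Glue _ p q) : cylinderMap r' p = cylinderMap r' q := by
  cases h
  · simp [cylinderMap]
  · norm_num [cylinderMap]

theorem quot_mk_eq_of_cylinderMap_eq {p q : Bool ⊕ (independentWeights r' × unitInterval)}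
    (h : cylinderMap r' p = cylinderMap r' q) :
    Quot.mk (UnreducedSuspension.Glue _) p = Quot.mk (UnreducedSuspension.Glue _) q := by
  -- Up to gluing, a point is a cone point, at height ±1, or lies strictly inside the cylinder,
  -- where the scaling factor 1 - |2s - 1| is nonzero and can be cancelled.
  have key : ∀ p : Bool ⊕ (independentWeights r' × unitInterval),
      (∃ b, Quot.mk (UnreducedSuspension.Glue _) p =
        Quot.mk (UnreducedSuspension.Glue _) (Sum.inl b)) ∨
      ∃ y s, p = Sum.inr (y, s) ∧ |2 * (s : ℝ) - 1| < 1 := by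
    rintro (b | ⟨y, s⟩)
    · exact .inl ⟨b, rfl⟩
    · by_cases h₀ : s = 0
      · exact .inl ⟨false, Quot.sound (h₀ ▸ .bot y)⟩
      by_cases h₁ : s = 1
      · exact .inl ⟨true, Quot.sound (h₁ ▸ .top y)⟩
      exact .inr ⟨y, s, rfl, abs_two_mul_sub_one_lt h₀ h₁⟩
  have lift : ∀ {p q}, Quot.mk (UnreducedSuspension.Glue _) p =
      Quot.mk (UnreducedSuspension.Glue _) q → cylinderMap r' p = cylinderMap r' q :=
    fun h => congrArg (Quot.lift (cylinderMap r') fun _ _ => cylinderMap_eq_of_glue) h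
  have habs : ∀ b : Bool, |(cylinderMap r' (Sum.inl b)).2| = 1 := by
    rintro (_ | _) <;> simp [cylinderMap]
  rcases key p with ⟨b, hb⟩ | ⟨y, s, rfl, hs⟩ <;> rcases key q with ⟨c, hc⟩ | ⟨z, t, rfl, ht⟩
  · rw [hb, hc]
    rw [lift hb, lift hc] at h
    have h := congrArg Prod.snd h
    have hbc : b = c := by
      cases b <;> cases c <;> first | rfl | (norm_num [cylinderMap] at h)
    rw [hbc]
  · have h' := habs b
    rw [← lift hb, h] at h'
    exact absurd h' ht.ne
  · have h' := habs c
    rw [← lift hc, ← h] at h'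
    exact absurd h' hs.ne
  · have hst : s = t := by
      have := congrArg Prod.snd h
      simp only [cylinderMap, Sum.elim_inr] at this
      ext
      linarith
    subst hst
    have hyz : y = z := by
      ext i
      have := congrFun (congrArg Prod.fst h) i
      simp only [cylinderMap, Sum.elim_inr, Pi.smul_apply, smul_eq_mul, extendZero_coe] at this
      exact mul_left_cancel₀ (by linarith) this
    rw [hyz]

theorem exists_cylinderMap_eq [Fintype V] (hr : ∀ i j : ↥Nᶜ, r' i j ↔ r i j) {p : (V → ℝ) × ℝ}
    (hp : p ∈ independentSuspension r N) : ∃ q, cylinderMap r' q = p := by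
  obtain ⟨z, t⟩ := p
  obtain ⟨h0, hN, hsum, hz⟩ := hp
  dsimp only at h0 hN hsum hz
  have hsum0 : 0 ≤ ∑ i, z i := Finset.sum_nonneg fun i _ => h0 i
  rcases hsum0.eq_or_lt with h | h
  -- Without mass the point is a pole; otherwise z is normalized to total mass 1.
  · have hz0 : z = 0 := by
      ext i
      exact (Finset.sum_eq_zero_iff_of_nonneg fun i _ => h0 i).1 h.symm i (Finset.mem_univ i)
    rw [← h, zero_add] at hsum
    rcases (abs_eq zero_le_one).1 hsum with rfl | rfl
    · exact ⟨Sum.inl true, by simp [cylinderMap, hz0]⟩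
    · exact ⟨Sum.inl false, by simp [cylinderMap, hz0]⟩
  · have ht := abs_le.1 (show |t| ≤ 1 by linarith)
    have hext : extendZero N (fun i => z i / ∑ j, z j) = fun i => z i / ∑ j, z j := by
      ext i
      by_cases hi : i ∈ N
      · simp [extendZero_of_mem _ hi, hN i hi]
      · exact extendZero_coe (fun i : ↥Nᶜ => z i / ∑ j, z j) ⟨i, hi⟩
    refine ⟨Sum.inr (⟨fun i => z i / ∑ j, z j, fun i => div_nonneg (h0 i) hsum0, ?_,
      fun i j hij => ?_⟩, ⟨(t + 1) / 2, by linarith, by linarith⟩), ?_⟩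
    · rw [← sum_extendZero, hext, ← Finset.sum_div, div_self h.ne']
    · rw [div_mul_div_comm, hz i j ((hr i j).1 hij), zero_div]
    · have h2 : 2 * ((t + 1) / 2) - 1 = t := by ring
      have h3 : 1 - |t| = ∑ i, z i := by linarith
      simp only [cylinderMap, Sum.elim_inr, hext, h2, h3, Prod.mk.injEq, and_true]
      ext i
      simp only [Pi.smul_apply, smul_eq_mul]
      field_simp

theorem nonempty_unreducedSuspension_homeomorph [Fintype V] (hr : ∀ i j : ↥Nᶜ, r' i j ↔ r i j) :
    Nonempty (UnreducedSuspension (independentWeights r') ≃ₜ independentSuspension r N) := by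
  have := isCompact_iff_compactSpace.1 (isCompact_independentWeights r')
  have : CompactSpace (UnreducedSuspension (independentWeights r')) :=
    inferInstanceAs (CompactSpace (Quot _))
  let f : UnreducedSuspension (independentWeights r') → independentSuspension r N :=
    Quot.lift (fun p => ⟨cylinderMap r' p, cylinderMap_mem hr p⟩)
      fun _ _ h => Subtype.ext (cylinderMap_eq_of_glue h)
  have hf : Continuous f := continuous_quot_lift _ (continuous_cylinderMap.subtype_mk _)
  have hbij : Function.Bijective f := by
    constructor
    · rintro ⟨p⟩ ⟨q⟩ h
      exact quot_mk_eq_of_cylinderMap_eq (congrArg Subtype.val h)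
    · rintro ⟨p, hp⟩
      obtain ⟨q, hq⟩ := exists_cylinderMap_eq hr hp
      exact ⟨Quot.mk _ q, Subtype.ext hq⟩
  -- A continuous bijection from a compact space to a Hausdorff space.
  exact ⟨hf.homeoOfEquivCompactToT2 (f := Equiv.ofBijective f hbij)⟩

end Suspension

/-! ### Truncating weights and moving mass -/

section Truncation

variable {V : Type*} [DecidableEq V]

/-- Lower the weights on `S` by `c`, but not below zero. -/
def truncate (S : Finset V) (c : ℝ) (x : V → ℝ) (i : V) : ℝ :=
  x i - if i ∈ S then min (x i) c else 0

theorem truncate_nonneg {S : Finset V} {c : ℝ} {x : V → ℝ} {i : V} (hx : 0 ≤ x i) :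
    0 ≤ truncate S c x i := by
  unfold truncate
  split_ifs
  · linarith [min_le_left (x i) c]
  · simpa using hx

theorem truncate_eq_zero {S : Finset V} {c : ℝ} {x : V → ℝ} {i : V} (hi : i ∈ S) (hx : x i ≤ c) :
    truncate S c x i = 0 := by
  simp [truncate, hi, hx]

theorem truncate_eq_zero_of_eq_zero {S : Finset V} {c : ℝ} {x : V → ℝ} {i : V} (hc : 0 ≤ c)
    (hx : x i = 0) : truncate S c x i = 0 := by
  simp [truncate, hx, hc]

theorem truncate_of_notMem {S : Finset V} {c : ℝ} {x : V → ℝ} {i : V} (hi : i ∉ S) :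
    truncate S c x i = x i := by
  simp [truncate, hi]

theorem truncate_zero {S : Finset V} {x : V → ℝ} (hx : ∀ i, 0 ≤ x i) : truncate S 0 x = x := by
  ext i
  simp [truncate, hx i]

theorem sum_truncate [Fintype V] (S : Finset V) (c : ℝ) (x : V → ℝ) :
    ∑ i, truncate S c x i = ∑ i, x i - ∑ i ∈ S, min (x i) c := by
  simp [truncate, Finset.sum_sub_distrib]

theorem continuous_truncate (S : Finset V) :
    Continuous fun p : ℝ × (V → ℝ) => truncate S p.1 p.2 := by
  refine continuous_pi fun i => ?_
  unfold truncate
  split_ifs <;> fun_prop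

/-- Truncate the weights on `S` and add masses `p`, `q`, `s` at the points `u`, `v`, `w`. -/
def redistribute (S : Finset V) (u v w : V) (c p q s : ℝ) (x : V → ℝ) : V → ℝ :=
  truncate S c x + Pi.single u p + Pi.single v q + Pi.single w s

theorem continuous_redistribute (S : Finset V) (u v w : V) {X : Type*} [TopologicalSpace X]
    {c p q s : X → ℝ} {f : X → V → ℝ} (hc : Continuous c) (hp : Continuous p)
    (hq : Continuous q) (hs : Continuous s) (hf : Continuous f) :
    Continuous fun x => redistribute S u v w (c x) (p x) (q x) (s x) (f x) := by
  have h := (continuous_truncate S).comp (hc.prodMk hf)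
  have single : ∀ (a : V) {k : X → ℝ}, Continuous k →
      Continuous fun x => (Pi.single a (k x) : V → ℝ) :=
    fun a _ hk => (continuous_single (A := fun _ : V => ℝ) a).comp hk
  exact ((h.add (single u hp)).add (single v hq)).add (single w hs)

theorem sum_redistribute [Fintype V] (S : Finset V) (u v w : V) (c p q s : ℝ) (x : V → ℝ) :
    ∑ i, redistribute S u v w c p q s x i =
      ∑ i, x i - ∑ i ∈ S, min (x i) c + p + q + s := by
  simp [redistribute, Finset.sum_add_distrib, sum_truncate]

end Truncation

/-! ### The local configuration around u, v, w -/

/-- `v` has exactly the two neighbours `u` and `w`; apart from `v`, the neighbours of `u` form the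
set `A` and those of `w` form the set `B`, and these sets are disjoint. -/
structure IsSeparatedPath {V : Type*} (r : V → V → Prop) (u v w : V) (A B : Finset V) :
    Prop where
  symm : ∀ i j, r i j → r j i
  uv : u ≠ v
  uw : u ≠ w
  vw : v ≠ w
  left_iff : ∀ i, r u i ↔ i = v ∨ i ∈ A
  mid_iff : ∀ i, r v i ↔ i = u ∨ i = w
  right_iff : ∀ i, r w i ↔ i = v ∨ i ∈ B
  disjoint : Disjoint A B
  left_notMem : u ∉ A ∧ v ∉ A ∧ w ∉ A
  right_notMem : u ∉ B ∧ v ∉ B ∧ w ∉ B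

/-- The relation `r` together with all pairs between `A` and `B`. -/
def spanRel {V : Type*} (r : V → V → Prop) (A B : Finset V) (i j : V) : Prop :=
  r i j ∨ (i ∈ A ∧ j ∈ B) ∨ (i ∈ B ∧ j ∈ A)

namespace IsSeparatedPath

variable {V : Type*} {r : V → V → Prop} {u v w : V} {A B : Finset V}

theorem notMem_of_mem_left (h : IsSeparatedPath r u v w A B) {i : V} (hi : i ∈ A) :
    i ∉ ({u, v, w} : Set V) := by
  rintro (rfl | rfl | rfl)
  exacts [h.left_notMem.1 hi, h.left_notMem.2.1 hi, h.left_notMem.2.2 hi]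

theorem notMem_of_mem_right (h : IsSeparatedPath r u v w A B) {i : V} (hi : i ∈ B) :
    i ∉ ({u, v, w} : Set V) := by
  rintro (rfl | rfl | rfl)
  exacts [h.right_notMem.1 hi, h.right_notMem.2.1 hi, h.right_notMem.2.2 hi]

theorem symm_spanRel (h : IsSeparatedPath r u v w A B) (i j : V) :
    spanRel r A B i j → spanRel r A B j i := by
  rintro (h' | h' | h')
  exacts [.inl (h.symm _ _ h'), .inr (.inr h'.symm), .inr (.inl h'.symm)]

variable [DecidableEq V]

theorem redistribute_left (h : IsSeparatedPath r u v w A B) (c p q s : ℝ) (x : V → ℝ) :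
    redistribute (A ∪ B) u v w c p q s x u = x u + p := by
  simp [redistribute, truncate_of_notMem, h.left_notMem, h.right_notMem, h.uv, h.uw]

theorem redistribute_mid (h : IsSeparatedPath r u v w A B) (c p q s : ℝ) (x : V → ℝ) :
    redistribute (A ∪ B) u v w c p q s x v = x v + q := by
  simp [redistribute, truncate_of_notMem, h.left_notMem, h.right_notMem, h.uv.symm, h.vw]

theorem redistribute_right (h : IsSeparatedPath r u v w A B) (c p q s : ℝ) (x : V → ℝ) :
    redistribute (A ∪ B) u v w c p q s x w = x w + s := by
  simp [redistribute, truncate_of_notMem, h.left_notMem, h.right_notMem, h.uw.symm, h.vw.symm]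

theorem redistribute_other {c p q s : ℝ} {x : V → ℝ} {i : V} (hi : i ∉ ({u, v, w} : Set V)) :
    redistribute (A ∪ B) u v w c p q s x i = truncate (A ∪ B) c x i := by
  simp only [Set.mem_insert_iff, Set.mem_singleton_iff, not_or] at hi
  simp [redistribute, hi]

/-- Orthogonality of two weights along the edges of `r`, reduced to the edges at `u`, `v`, `w`
and the edges outside these points. -/
theorem mul_eq_zero_of_rel (h : IsSeparatedPath r u v w A B) {x y : V → ℝ}
    (huv : x u * y v = 0) (hvu : x v * y u = 0) (hvw : x v * y w = 0) (hwv : x w * y v = 0)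
    (huA : ∀ i ∈ A, x u * y i = 0) (hAu : ∀ i ∈ A, x i * y u = 0)
    (hwB : ∀ i ∈ B, x w * y i = 0) (hBw : ∀ i ∈ B, x i * y w = 0)
    (hxy : ∀ i j, i ∉ ({u, v, w} : Set V) → j ∉ ({u, v, w} : Set V) → r i j → x i * y j = 0)
    (i j : V) (hij : r i j) : x i * y j = 0 := by
  have edge : ∀ {i}, i ∈ ({u, v, w} : Set V) → ∀ {j}, r i j →
      x i * y j = 0 ∧ x j * y i = 0 := by
    rintro i (rfl | rfl | rfl) j hij
    · rcases (h.left_iff j).1 hij with rfl | hj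
      exacts [⟨huv, hvu⟩, ⟨huA j hj, hAu j hj⟩]
    · rcases (h.mid_iff j).1 hij with rfl | rfl
      exacts [⟨hvu, huv⟩, ⟨hvw, hwv⟩]
    · rcases (h.right_iff j).1 hij with rfl | hj
      exacts [⟨hwv, hvw⟩, ⟨hwB j hj, hBw j hj⟩]
  by_cases hi : i ∈ ({u, v, w} : Set V)
  · exact (edge hi hij).1
  by_cases hj : j ∈ ({u, v, w} : Set V)
  · exact (edge hj (h.symm _ _ hij)).2
  exact hxy i j hi hj hij

theorem sum_union (h : IsSeparatedPath r u v w A B) (f : V → ℝ) :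
    ∑ i ∈ A ∪ B, f i = ∑ i ∈ A, f i + ∑ i ∈ B, f i :=
  Finset.sum_union h.disjoint

end IsSeparatedPath

/-! ### The maps between the two models -/

section SuspensionMaps

variable {V : Type*}

/-- The common mass of a weight on two sets. -/
def commonMass (A B : Finset V) (x : V → ℝ) : ℝ := min (∑ i ∈ A, x i) (∑ i ∈ B, x i)

/-- The total mass that truncation at level `c` removes from the weights on `S`. -/
def removedMass (S : Finset V) (c : ℝ) (x : V → ℝ) : ℝ := ∑ i ∈ S, min (x i) c

/-- The map from the independent weights to the suspension model. -/
def toSuspension [DecidableEq V] (u v w : V) (A B : Finset V) (x : V → ℝ) : (V → ℝ) × ℝ :=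
  -- The negative summands empty u, v and w.
  (redistribute (A ∪ B) u v w (commonMass A B x) (-x u) (-x v) (-x w) x,
    x v + removedMass A (commonMass A B x) x + removedMass B (commonMass A B x) x -
      (x u + x w))

/-- The mass placed at the neighbour of `A` when truncating at level `c`. -/
noncomputable def sideMass (A B : Finset V) (c : ℝ) (x : V → ℝ) : ℝ :=
  max (c - ∑ i ∈ A, x i) 0 / 2 + removedMass B c x + (c - max (c - ∑ i ∈ B, x i) 0) / 2

/-- The map from the suspension model to the independent weights. -/
noncomputable def ofSuspension [DecidableEq V] (u v w : V) (A B : Finset V) (p : (V → ℝ) × ℝ) :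
    V → ℝ :=
  redistribute (A ∪ B) u v w (max (-p.2) 0) (sideMass A B (max (-p.2) 0) p.1) (max p.2 0)
    (sideMass B A (max (-p.2) 0) p.1) p.1

/-- A self-map of the independent weights that moves mass from `A` to `w` and from `B` to `u`. -/
def pushMass [DecidableEq V] (u v w : V) (A B : Finset V) (x : V → ℝ) : V → ℝ :=
  redistribute (A ∪ B) u v w (x u + x w) (removedMass B (x u + x w) x) 0
    (removedMass A (x u + x w) x) x

theorem continuous_commonMass (A B : Finset V) : Continuous (commonMass A B) := by
  unfold commonMass
  fun_prop

theorem continuous_removedMass (S : Finset V) {X : Type*} [TopologicalSpace X] {c : X → ℝ}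
    {f : X → V → ℝ} (hc : Continuous c) (hf : Continuous f) :
    Continuous fun x => removedMass S (c x) (f x) := by
  unfold removedMass
  fun_prop

theorem continuous_toSuspension [DecidableEq V] (u v w : V) (A B : Finset V) :
    Continuous (toSuspension u v w A B) := by
  have h := continuous_commonMass A B
  have hA := continuous_removedMass A h continuous_id
  have hB := continuous_removedMass B h continuous_id
  simp only [id] at hA hB
  exact (continuous_redistribute _ u v w h (by fun_prop) (by fun_prop) (by fun_prop)
    continuous_id).prodMk (by fun_prop)

theorem continuous_sideMass [DecidableEq V] (A B : Finset V) :
    Continuous fun p : (V → ℝ) × ℝ => sideMass A B (max (-p.2) 0) p.1 := by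
  have h := continuous_removedMass B (X := (V → ℝ) × ℝ) (c := fun p => max (-p.2) 0)
    (f := Prod.fst) (by fun_prop) (by fun_prop)
  unfold sideMass
  fun_prop

theorem continuous_ofSuspension [DecidableEq V] (u v w : V) (A B : Finset V) :
    Continuous (ofSuspension u v w A B) :=
  continuous_redistribute _ u v w (by fun_prop) (continuous_sideMass A B) (by fun_prop)
    (continuous_sideMass B A) continuous_fst

theorem continuous_pushMass [DecidableEq V] (u v w : V) (A B : Finset V) :
    Continuous (pushMass u v w A B) :=
  continuous_redistribute _ u v w (by fun_prop)
    (continuous_removedMass _ (by fun_prop) continuous_id) continuous_const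
    (continuous_removedMass _ (by fun_prop) continuous_id) continuous_id

theorem removedMass_nonneg {S : Finset V} {c : ℝ} {x : V → ℝ} (hc : 0 ≤ c)
    (hx : ∀ i, 0 ≤ x i) : 0 ≤ removedMass S c x :=
  Finset.sum_nonneg fun i _ => le_min (hx i) hc

theorem removedMass_le_sum {S : Finset V} {c : ℝ} {x : V → ℝ} :
    removedMass S c x ≤ ∑ i ∈ S, x i :=
  Finset.sum_le_sum fun _ _ => min_le_left _ _

theorem removedMass_zero {S : Finset V} {x : V → ℝ} (hx : ∀ i, 0 ≤ x i) :
    removedMass S 0 x = 0 :=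
  Finset.sum_eq_zero fun i _ => min_eq_right (hx i)

theorem le_sum_of_mem {S : Finset V} {x : V → ℝ} (hx : ∀ i, 0 ≤ x i) {i : V} (hi : i ∈ S) :
    x i ≤ ∑ j ∈ S, x j :=
  Finset.single_le_sum (fun j _ => hx j) hi

theorem sum_nonneg_of_nonneg {S : Finset V} {x : V → ℝ} (hx : ∀ i, 0 ≤ x i) :
    0 ≤ ∑ j ∈ S, x j :=
  Finset.sum_nonneg fun j _ => hx j

theorem sideMass_nonneg [DecidableEq V] {A B : Finset V} {c : ℝ} {x : V → ℝ} (hc : 0 ≤ c)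
    (hx : ∀ i, 0 ≤ x i) : 0 ≤ sideMass A B c x := by
  have h₁ : 0 ≤ max (c - ∑ i ∈ A, x i) 0 := le_max_right _ _
  have h₂ : max (c - ∑ i ∈ B, x i) 0 ≤ c :=
    max_le (by linarith [sum_nonneg_of_nonneg (S := B) hx]) hc
  have h₃ := removedMass_nonneg (S := B) hc hx
  unfold sideMass
  linarith

theorem sideMass_zero [DecidableEq V] {A B : Finset V} {x : V → ℝ} (hx : ∀ i, 0 ≤ x i) :
    sideMass A B 0 x = 0 := by
  have hA := sum_nonneg_of_nonneg (S := A) hx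
  have hB := sum_nonneg_of_nonneg (S := B) hx
  simp [sideMass, removedMass_zero hx, hA, hB]

/-- The two shares use up exactly c and the truncated mass, so `ofSuspension` preserves total mass.
-/
theorem sideMass_add_sideMass (A B : Finset V) (c : ℝ) (x : V → ℝ) :
    sideMass A B c x + sideMass B A c x = c + removedMass A c x + removedMass B c x := by
  unfold sideMass
  ring

/-- If a point of A survives truncation, then A carries more than c, so B carries nothing and each
term of the share of u vanishes. -/
theorem sideMass_mul_truncate [DecidableEq V] {A B S : Finset V} {c : ℝ} {x : V → ℝ} (hc : 0 ≤ c)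
    (hx : ∀ i, 0 ≤ x i) (hAB : (∑ i ∈ A, x i) * ∑ i ∈ B, x i = 0) (hS : A ⊆ S) {i : V}
    (hi : i ∈ A) : sideMass A B c x * truncate S c x i = 0 := by
  rcases le_or_gt (x i) c with hic | hic
  · rw [truncate_eq_zero (hS hi) hic, mul_zero]
  · have hA : c < ∑ i ∈ A, x i := hic.trans_le (le_sum_of_mem hx hi)
    have hB : ∑ i ∈ B, x i = 0 := (mul_eq_zero.1 hAB).resolve_left (by linarith)
    have hB' : removedMass B c x = 0 :=
      le_antisymm (removedMass_le_sum.trans hB.le) (removedMass_nonneg hc hx)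
    simp [sideMass, hB, hB', hA.le, hc]

end SuspensionMaps

/-! ### Both maps land in the right spaces -/

namespace IsSeparatedPath

variable {V : Type*} {r : V → V → Prop} {u v w : V} {A B : Finset V}

theorem mul_sum_left [Fintype V] (h : IsSeparatedPath r u v w A B) {x : V → ℝ}
    (hx : x ∈ independentWeights r) : x u * ∑ i ∈ A, x i = 0 := by
  rw [Finset.mul_sum]
  exact Finset.sum_eq_zero fun i hi => hx.2.2 u i ((h.left_iff i).2 (.inr hi))

theorem mul_sum_right [Fintype V] (h : IsSeparatedPath r u v w A B) {x : V → ℝ}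
    (hx : x ∈ independentWeights r) : x w * ∑ i ∈ B, x i = 0 := by
  rw [Finset.mul_sum]
  exact Finset.sum_eq_zero fun i hi => hx.2.2 w i ((h.right_iff i).2 (.inr hi))

theorem mid_mul_ends [Fintype V] (h : IsSeparatedPath r u v w A B) {x : V → ℝ}
    (hx : x ∈ independentWeights r) : x v * (x u + x w) = 0 := by
  rw [mul_add, hx.2.2 v u ((h.mid_iff u).2 (.inl rfl)),
    hx.2.2 v w ((h.mid_iff w).2 (.inr rfl)), add_zero]

theorem sum_redistribute' [Fintype V] [DecidableEq V] (h : IsSeparatedPath r u v w A B)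
    (c p q s : ℝ) (x : V → ℝ) :
    ∑ i, redistribute (A ∪ B) u v w c p q s x i =
      ∑ i, x i - (removedMass A c x + removedMass B c x) + p + q + s := by
  rw [sum_redistribute, h.sum_union]
  rfl

theorem commonMass_nonneg [DecidableEq V] {x : V → ℝ} (hx : ∀ i, 0 ≤ x i) : 0 ≤ commonMass A B x :=
  le_min (sum_nonneg_of_nonneg hx) (sum_nonneg_of_nonneg hx)

/-- Weight at u forces zero weight on v and A; weight at w forces it on v and B. Thus the positive
and negative contributions to the height never occur together. -/
theorem ends_or_commonMass [Fintype V] [DecidableEq V] (h : IsSeparatedPath r u v w A B) {x : V → ℝ}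
    (hx : x ∈ independentWeights r) :
    (x u = 0 ∧ x w = 0) ∨ (x v = 0 ∧ commonMass A B x = 0) := by
  have hA := sum_nonneg_of_nonneg (S := A) hx.1
  have hB := sum_nonneg_of_nonneg (S := B) hx.1
  by_cases hu : x u = 0
  · by_cases hw : x w = 0
    · exact .inl ⟨hu, hw⟩
    · have hB0 := (mul_eq_zero.1 (h.mul_sum_right hx)).resolve_left hw
      have := h.mid_mul_ends hx
      rw [hu, zero_add] at this
      exact .inr ⟨(mul_eq_zero.1 this).resolve_right hw, by simp [commonMass, hB0, hA]⟩
  · have hA0 := (mul_eq_zero.1 (h.mul_sum_left hx)).resolve_left hu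
    have hne : x u + x w ≠ 0 := by
      have := (hx.1 u).lt_of_ne' hu
      have := hx.1 w
      positivity
    exact .inr ⟨(mul_eq_zero.1 (h.mid_mul_ends hx)).resolve_right hne,
      by simp [commonMass, hA0, hB]⟩

theorem abs_toSuspension [Fintype V] [DecidableEq V] (h : IsSeparatedPath r u v w A B) {x : V → ℝ}
    (hx : x ∈ independentWeights r) :
    |(toSuspension u v w A B x).2| = x v + removedMass A (commonMass A B x) x +
      removedMass B (commonMass A B x) x + x u + x w := by
  have hm := commonMass_nonneg (A := A) (B := B) hx.1
  have hA := removedMass_nonneg (S := A) hm hx.1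
  have hB := removedMass_nonneg (S := B) hm hx.1
  have hu := hx.1 u
  have hv := hx.1 v
  have hw := hx.1 w
  rcases h.ends_or_commonMass hx with ⟨h₁, h₂⟩ | ⟨h₁, h₂⟩
  · simp only [toSuspension, h₁, h₂]
    rw [abs_of_nonneg (by linarith)]
    ring
  · simp only [toSuspension, h₁, h₂, removedMass_zero hx.1]
    rw [abs_of_nonpos (by linarith)]
    ring

theorem eq_zero_of_redistribute_cancel [DecidableEq V] (h : IsSeparatedPath r u v w A B) (c : ℝ)
    (x : V → ℝ)
    {i : V} (hi : i ∈ ({u, v, w} : Set V)) :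
    redistribute (A ∪ B) u v w c (-x u) (-x v) (-x w) x i = 0 := by
  rcases hi with rfl | rfl | rfl
  · rw [h.redistribute_left, add_neg_cancel]
  · rw [h.redistribute_mid, add_neg_cancel]
  · rw [h.redistribute_right, add_neg_cancel]

/-- On the lighter of A and B every single weight is at most the total there, which is the
truncation level; that side is wiped out. -/
theorem truncate_commonMass_mul [DecidableEq V] {x : V → ℝ} (hx : ∀ i, 0 ≤ x i) {i j : V}
    (hi : i ∈ A)
    (hj : j ∈ B) : truncate (A ∪ B) (commonMass A B x) x i *
      truncate (A ∪ B) (commonMass A B x) x j = 0 := by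
  rcases le_total (∑ i ∈ A, x i) (∑ i ∈ B, x i) with hAB | hAB
  · rw [truncate_eq_zero (Finset.mem_union_left _ hi), zero_mul]
    rw [commonMass, min_eq_left hAB]
    exact le_sum_of_mem hx hi
  · rw [truncate_eq_zero (i := j) (Finset.mem_union_right _ hj), mul_zero]
    rw [commonMass, min_eq_right hAB]
    exact le_sum_of_mem hx hj

theorem truncate_mul_eq_zero [DecidableEq V] {S : Finset V} {c : ℝ} (hc : 0 ≤ c) {x y : V → ℝ}
    {i j : V}
    (hxy : x i * y j = 0) : truncate S c x i * y j = 0 := by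
  rcases mul_eq_zero.1 hxy with h | h
  · rw [truncate_eq_zero_of_eq_zero hc h, zero_mul]
  · rw [h, mul_zero]

theorem mul_truncate_eq_zero [DecidableEq V] {S : Finset V} {c : ℝ} (hc : 0 ≤ c) {x y : V → ℝ}
    {i j : V}
    (hxy : x i * y j = 0) : x i * truncate S c y j = 0 := by
  rcases mul_eq_zero.1 hxy with h | h
  · rw [h, zero_mul]
  · rw [truncate_eq_zero_of_eq_zero hc h, mul_zero]

theorem toSuspension_mem [Fintype V] [DecidableEq V] (h : IsSeparatedPath r u v w A B) {x : V → ℝ}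
    (hx : x ∈ independentWeights r) :
    toSuspension u v w A B x ∈ independentSuspension (spanRel r A B) {u, v, w} := by
  have hm := commonMass_nonneg (A := A) (B := B) hx.1
  refine ⟨fun i => ?_, fun i hi => h.eq_zero_of_redistribute_cancel _ _ hi, ?_,
    fun i j hij => ?_⟩
  · by_cases hi : i ∈ ({u, v, w} : Set V)
    · exact (h.eq_zero_of_redistribute_cancel _ _ hi).ge
    · exact (redistribute_other hi).ge.trans' (truncate_nonneg (hx.1 i))
  · have := hx.2.1
    rw [h.abs_toSuspension hx, toSuspension, h.sum_redistribute']
    linarith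
  · by_cases hi : i ∈ ({u, v, w} : Set V)
    · simp [toSuspension, h.eq_zero_of_redistribute_cancel _ _ hi]
    by_cases hj : j ∈ ({u, v, w} : Set V)
    · simp [toSuspension, h.eq_zero_of_redistribute_cancel _ _ hj]
    simp only [toSuspension, redistribute_other hi, redistribute_other hj]
    rcases hij with hij | ⟨hi, hj⟩ | ⟨hi, hj⟩
    · exact truncate_mul_eq_zero hm (mul_truncate_eq_zero hm (hx.2.2 i j hij))
    · exact truncate_commonMass_mul hx.1 hi hj
    · rw [mul_comm]
      exact truncate_commonMass_mul hx.1 hj hi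

theorem sum_mul_sum_eq_zero [Fintype V] {N : Set V} {p : (V → ℝ) × ℝ}
    (hp : p ∈ independentSuspension (spanRel r A B) N) :
    (∑ i ∈ A, p.1 i) * ∑ i ∈ B, p.1 i = 0 := by
  rw [Finset.sum_mul_sum]
  exact Finset.sum_eq_zero fun i hi => Finset.sum_eq_zero fun j hj =>
    hp.2.2.2 i j (.inr (.inl ⟨hi, hj⟩))

theorem max_mul_max_neg (t : ℝ) : max t 0 * max (-t) 0 = 0 := by
  rcases le_total t 0 with ht | ht <;> simp [ht]

/-- Mass is put at v only for t > 0 and at u, w only for t < 0. -/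
theorem max_mul_sideMass [DecidableEq V] (t : ℝ) {x : V → ℝ} (hx : ∀ i, 0 ≤ x i) :
    max t 0 * sideMass A B (max (-t) 0) x = 0 := by
  rcases mul_eq_zero.1 (max_mul_max_neg t) with ht | ht
  · rw [ht, zero_mul]
  · rw [ht, sideMass_zero hx, mul_zero]

theorem ofSuspension_values [Fintype V] [DecidableEq V] (h : IsSeparatedPath r u v w A B) {p :
    (V → ℝ) × ℝ}
    (hp : p ∈ independentSuspension (spanRel r A B) {u, v, w}) :
    ofSuspension u v w A B p u = sideMass A B (max (-p.2) 0) p.1 ∧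
      ofSuspension u v w A B p v = max p.2 0 ∧
      ofSuspension u v w A B p w = sideMass B A (max (-p.2) 0) p.1 := by
  simp [ofSuspension, h.redistribute_left, h.redistribute_mid, h.redistribute_right,
    hp.2.1]

theorem ofSuspension_other [DecidableEq V] {p : (V → ℝ) × ℝ} {i : V} (hi : i ∉
    ({u, v, w} : Set V)) :
    ofSuspension u v w A B p i = truncate (A ∪ B) (max (-p.2) 0) p.1 i :=
  redistribute_other hi

theorem ofSuspension_mem [Fintype V] [DecidableEq V] (h : IsSeparatedPath r u v w A B) {p :
    (V → ℝ) × ℝ}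
    (hp : p ∈ independentSuspension (spanRel r A B) {u, v, w}) :
    ofSuspension u v w A B p ∈ independentWeights r := by
  obtain ⟨hu, hv, hw⟩ := h.ofSuspension_values hp
  have hc : 0 ≤ max (-p.2) 0 := le_max_right _ _
  have hAB := sum_mul_sum_eq_zero hp
  have hBA := (mul_comm _ _).trans hAB
  refine ⟨fun i => ?_, ?_, h.mul_eq_zero_of_rel ?_ ?_ ?_ ?_ (fun i hi => ?_) (fun i hi => ?_)
    (fun i hi => ?_) (fun i hi => ?_) fun i j hi hj hij => ?_⟩
  · by_cases hi : i ∈ ({u, v, w} : Set V)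
    · rcases hi with rfl | rfl | rfl
      · exact hu.ge.trans' (sideMass_nonneg hc hp.1)
      · exact hv.ge.trans' (le_max_right _ _)
      · exact hw.ge.trans' (sideMass_nonneg hc hp.1)
    · exact (ofSuspension_other hi).ge.trans' (truncate_nonneg (hp.1 i))
  · have h₁ := sideMass_add_sideMass A B (max (-p.2) 0) p.1
    have h₂ := hp.2.2.1
    have h₃ : |p.2| = max p.2 0 + max (-p.2) 0 := by
      rcases le_total p.2 0 with ht | ht <;> simp [ht, abs_of_nonneg, abs_of_nonpos]
    rw [ofSuspension, h.sum_redistribute']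
    linarith
  · rw [hu, hv, mul_comm, max_mul_sideMass _ hp.1]
  · rw [hu, hv, max_mul_sideMass _ hp.1]
  · rw [hw, hv, max_mul_sideMass _ hp.1]
  · rw [hw, hv, mul_comm, max_mul_sideMass _ hp.1]
  · rw [hu, ofSuspension_other (h.notMem_of_mem_left hi)]
    exact sideMass_mul_truncate hc hp.1 hAB Finset.subset_union_left hi
  · rw [hu, ofSuspension_other (h.notMem_of_mem_left hi), mul_comm]
    exact sideMass_mul_truncate hc hp.1 hAB Finset.subset_union_left hi
  · rw [hw, ofSuspension_other (h.notMem_of_mem_right hi)]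
    exact sideMass_mul_truncate hc hp.1 hBA Finset.subset_union_right hi
  · rw [hw, ofSuspension_other (h.notMem_of_mem_right hi), mul_comm]
    exact sideMass_mul_truncate hc hp.1 hBA Finset.subset_union_right hi
  · rw [ofSuspension_other hi, ofSuspension_other hj]
    exact truncate_mul_eq_zero hc (mul_truncate_eq_zero hc (hp.2.2.2 i j (.inl hij)))

end IsSeparatedPath

/-! ### The homotopies -/

namespace IsSeparatedPath

variable {V : Type*} {r : V → V → Prop} {u v w : V} {A B : Finset V}

/-- No support is created: u can receive mass only from B at a level x u + x w. If x u = 0, then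
either x w = 0 and the level is zero, or B is empty of mass. The case of w is symmetric. -/
theorem pushMass_eq_zero [Fintype V] [DecidableEq V] (h : IsSeparatedPath r u v w A B) {x : V → ℝ}
    (hx : x ∈ independentWeights r) {i : V} (hi : x i = 0) : pushMass u v w A B x i = 0 := by
  have hc : 0 ≤ x u + x w := add_nonneg (hx.1 u) (hx.1 w)
  by_cases hN : i ∈ ({u, v, w} : Set V)
  · rcases hN with rfl | rfl | rfl
    · rw [pushMass, h.redistribute_left, hi, zero_add, zero_add]
      rcases mul_eq_zero.1 (h.mul_sum_right hx) with hw | hB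
      · rw [hw, removedMass_zero hx.1]
      · exact le_antisymm (removedMass_le_sum.trans hB.le)
          (removedMass_nonneg (hx.1 w) hx.1)
    · rw [pushMass, h.redistribute_mid, hi, add_zero]
    · rw [pushMass, h.redistribute_right, hi, zero_add, add_zero]
      rcases mul_eq_zero.1 (h.mul_sum_left hx) with hu | hA
      · rw [hu, removedMass_zero hx.1]
      · exact le_antisymm (removedMass_le_sum.trans hA.le)
          (removedMass_nonneg (hx.1 u) hx.1)
  · rw [pushMass, redistribute_other hN, truncate_eq_zero_of_eq_zero hc hi]

theorem pushMass_mem [Fintype V] [DecidableEq V] (h : IsSeparatedPath r u v w A B) {x : V → ℝ}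
    (hx : x ∈ independentWeights r) : pushMass u v w A B x ∈ independentWeights r := by
  have hc : 0 ≤ x u + x w := add_nonneg (hx.1 u) (hx.1 w)
  refine ⟨fun i => ?_, ?_, fun i j hij => ?_⟩
  · by_cases hN : i ∈ ({u, v, w} : Set V)
    · rcases hN with rfl | rfl | rfl
      · rw [pushMass, h.redistribute_left]
        exact add_nonneg (hx.1 _) (removedMass_nonneg hc hx.1)
      · rw [pushMass, h.redistribute_mid, add_zero]
        exact hx.1 _
      · rw [pushMass, h.redistribute_right]
        exact add_nonneg (hx.1 _) (removedMass_nonneg hc hx.1)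
    · exact (redistribute_other hN).ge.trans' (truncate_nonneg (hx.1 i))
  · have := hx.2.1
    rw [pushMass, h.sum_redistribute']
    linarith
  · rcases mul_eq_zero.1 (hx.2.2 i j hij) with h0 | h0
    · rw [h.pushMass_eq_zero hx h0, zero_mul]
    · rw [h.pushMass_eq_zero hx h0, mul_zero]

theorem segment_pushMass_subset [Fintype V] [DecidableEq V] (h : IsSeparatedPath r u v w A B)
    {x : V → ℝ}
    (hx : x ∈ independentWeights r) :
    segment ℝ x (pushMass u v w A B x) ⊆ independentWeights r := by
  refine segment_subset_independentWeights h.symm hx (h.pushMass_mem hx) fun i j hij => ?_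
  rcases mul_eq_zero.1 (hx.2.2 i j hij) with h0 | h0
  · rw [h0, zero_mul]
  · rw [h.pushMass_eq_zero hx h0, mul_zero]

theorem toSuspension_other [DecidableEq V] {x : V → ℝ} {i : V} (hi : i ∉ ({u, v, w} : Set V)) :
    (toSuspension u v w A B x).1 i = truncate (A ∪ B) (commonMass A B x) x i :=
  redistribute_other hi

theorem toSuspension_snd_nonneg [DecidableEq V] {x : V → ℝ} (hx : ∀ i, 0 ≤ x i) (hu : x u = 0)
    (hw : x w = 0) : 0 ≤ (toSuspension u v w A B x).2 := by
  have hm := commonMass_nonneg (A := A) (B := B) hx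
  have hA := removedMass_nonneg (S := A) hm hx
  have hB := removedMass_nonneg (S := B) hm hx
  have hv := hx v
  simp only [toSuspension, hu, hw]
  linarith

theorem toSuspension_snd_of_commonMass_eq_zero [DecidableEq V] {x : V → ℝ} (hx : ∀ i, 0 ≤ x i)
    (hv : x v = 0) (hm : commonMass A B x = 0) :
    (toSuspension u v w A B x).2 = -(x u + x w) := by
  simp [toSuspension, hv, hm, removedMass_zero hx]

theorem segment_pushMass_ofSuspension_subset [Fintype V] [DecidableEq V]
    (h : IsSeparatedPath r u v w A B) {x : V → ℝ}
    (hx : x ∈ independentWeights r) :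
    segment ℝ (pushMass u v w A B x) (ofSuspension u v w A B (toSuspension u v w A B x)) ⊆
      independentWeights r := by
  have hF := h.toSuspension_mem hx
  have hG := h.ofSuspension_mem hF
  have hP := h.pushMass_mem hx
  obtain ⟨hu, hv, hw⟩ := h.ofSuspension_values hF
  refine segment_subset_independentWeights h.symm hP hG ?_
  rcases h.ends_or_commonMass hx with ⟨h₁, h₂⟩ | ⟨h₁, h₂⟩
  -- Upper half: neither endpoint charges u or w, and elsewhere off v both supports lie in that of
  -- x.
  · have ht := toSuspension_snd_nonneg (v := v) (A := A) (B := B) hx.1 h₁ h₂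
    have hc : max (-(toSuspension u v w A B x).2) 0 = 0 := max_eq_right (by linarith)
    rw [hc, sideMass_zero hF.1] at hu hw
    have hPu := h.pushMass_eq_zero hx h₁
    have hPw := h.pushMass_eq_zero hx h₂
    refine h.mul_eq_zero_of_rel ?_ ?_ ?_ ?_ ?_ ?_ ?_ ?_ fun i j hi hj hij => ?_
    any_goals simp [hu, hw, hPu, hPw]
    rw [ofSuspension_other hj, hc, truncate_zero hF.1, toSuspension_other hj]
    rcases mul_eq_zero.1 (hx.2.2 i j hij) with h0 | h0
    · exact .inl (h.pushMass_eq_zero hx h0)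
    · exact .inr (truncate_eq_zero_of_eq_zero (commonMass_nonneg hx.1) h0)
  · have ht := toSuspension_snd_of_commonMass_eq_zero (u := u) (w := w) hx.1 h₁ h₂
    have hc : 0 ≤ x u + x w := add_nonneg (hx.1 u) (hx.1 w)
    rw [ht, max_eq_right (by linarith)] at hv
    have hPv := h.pushMass_eq_zero hx h₁
    -- Lower half: `toSuspension` truncates nothing and has height -(x u + x w), so the way back
    -- truncates at the same level as `pushMass`. The endpoints differ only at u and w, and cross
    -- products reduce to products within one endpoint.
    have heq : ∀ i, i ∉ ({u, v, w} : Set V) →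
        ofSuspension u v w A B (toSuspension u v w A B x) i = pushMass u v w A B x i := by
      intro i hi
      rw [ofSuspension_other hi, ht, neg_neg, max_eq_left hc, pushMass, redistribute_other hi]
      have := toSuspension_other (A := A) (B := B) (x := x) hi
      rw [h₂, truncate_zero hx.1] at this
      simp only [truncate, this]
    refine h.mul_eq_zero_of_rel ?_ ?_ ?_ ?_ (fun i hi => ?_) (fun i hi => ?_) (fun i hi => ?_)
      (fun i hi => ?_) fun i j hi hj hij => ?_
    · rw [hv, mul_zero]
    · rw [hPv, zero_mul]
    · rw [hPv, zero_mul]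
    · rw [hv, mul_zero]
    · rw [heq i (h.notMem_of_mem_left hi)]
      exact hP.2.2 u i ((h.left_iff i).2 (.inr hi))
    · rw [← heq i (h.notMem_of_mem_left hi)]
      exact hG.2.2 i u (h.symm _ _ ((h.left_iff i).2 (.inr hi)))
    · rw [heq i (h.notMem_of_mem_right hi)]
      exact hP.2.2 w i ((h.right_iff i).2 (.inr hi))
    · rw [← heq i (h.notMem_of_mem_right hi)]
      exact hG.2.2 i w (h.symm _ _ ((h.right_iff i).2 (.inr hi)))
    · rw [heq j hj]
      exact hP.2.2 i j hij

/-- The round trip respects the two cones, so the segment back to p does not cross between them. -/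
theorem mul_toSuspension_snd_nonneg [Fintype V] [DecidableEq V] (h : IsSeparatedPath r u v w A B)
    {p : (V → ℝ) × ℝ}
    (hp : p ∈ independentSuspension (spanRel r A B) {u, v, w}) :
    0 ≤ p.2 * (toSuspension u v w A B (ofSuspension u v w A B p)).2 := by
  have hG := h.ofSuspension_mem hp
  obtain ⟨hu, hv, hw⟩ := h.ofSuspension_values hp
  rcases le_or_gt 0 p.2 with ht | ht
  · rw [max_eq_right (by linarith : -p.2 ≤ 0), sideMass_zero hp.1] at hu hw
    exact mul_nonneg ht (toSuspension_snd_nonneg hG.1 hu hw)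
  · have hc : max (-p.2) 0 = -p.2 := max_eq_left (by linarith)
    have hsum := sideMass_add_sideMass A B (max (-p.2) 0) p.1
    have hA := removedMass_nonneg (S := A) (le_max_right (-p.2) 0) hp.1
    have hB := removedMass_nonneg (S := B) (le_max_right (-p.2) 0) hp.1
    rw [← hu, ← hw] at hsum
    rcases h.ends_or_commonMass hG with ⟨h₁, h₂⟩ | ⟨h₁, h₂⟩
    -- Impossible: below height 0 the masses at u and w add up to at least -p.2 > 0.
    · rw [h₁, h₂] at hsum
      linarith
    · rw [toSuspension_snd_of_commonMass_eq_zero hG.1 h₁ h₂]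
      exact mul_nonneg_of_nonpos_of_nonpos ht.le (by linarith)

theorem segment_toSuspension_ofSuspension_subset [Fintype V] [DecidableEq V]
    (h : IsSeparatedPath r u v w A B)
    {p : (V → ℝ) × ℝ} (hp : p ∈ independentSuspension (spanRel r A B) {u, v, w}) :
    segment ℝ (toSuspension u v w A B (ofSuspension u v w A B p)) p ⊆
      independentSuspension (spanRel r A B) {u, v, w} := by
  have hG := h.ofSuspension_mem hp
  have hF := h.toSuspension_mem hG
  rw [segment_symm]
  refine segment_subset_independentSuspension h.symm_spanRel hp hF (fun i j hij => ?_)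
    (h.mul_toSuspension_snd_nonneg hp)
  by_cases hj : j ∈ ({u, v, w} : Set V)
  · rw [hF.2.1 j hj, mul_zero]
  rw [toSuspension_other hj]
  -- Off u, v, w both maps only truncate, so the support shrinks.
  refine mul_truncate_eq_zero (commonMass_nonneg hG.1) ?_
  rw [ofSuspension_other hj]
  exact mul_truncate_eq_zero (le_max_right _ _) (hp.2.2.2 i j hij)

theorem nonempty_homotopyEquiv [Fintype V] [DecidableEq V] (h : IsSeparatedPath r u v w A B) :
    Nonempty (independentWeights r ≃ₕ
      independentSuspension (spanRel r A B) ({u, v, w} : Set V)) := by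
  let f : C(independentWeights r, independentSuspension (spanRel r A B) ({u, v, w} : Set V)) :=
    ⟨fun x => ⟨_, h.toSuspension_mem x.2⟩,
      ((continuous_toSuspension u v w A B).comp continuous_subtype_val).subtype_mk _⟩
  let g : C(independentSuspension (spanRel r A B) ({u, v, w} : Set V), independentWeights r) :=
    ⟨fun p => ⟨_, h.ofSuspension_mem p.2⟩,
      ((continuous_ofSuspension u v w A B).comp continuous_subtype_val).subtype_mk _⟩
  let k : C(independentWeights r, independentWeights r) :=
    ⟨fun x => ⟨_, h.pushMass_mem x.2⟩,
      ((continuous_pushMass u v w A B).comp continuous_subtype_val).subtype_mk _⟩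
  refine ⟨⟨f, g, ?_, ?_⟩⟩
  · have h₁ : (ContinuousMap.id (independentWeights r)).Homotopic k :=
      .of_segment_subset _ _ fun x => h.segment_pushMass_subset x.2
    have h₂ : k.Homotopic (g.comp f) :=
      .of_segment_subset _ _ fun x => h.segment_pushMass_ofSuspension_subset x.2
    exact (h₁.trans h₂).symm
  · exact .of_segment_subset _ _ fun p => h.segment_toSuspension_ofSuspension_subset p.2

end IsSeparatedPath

/-! ### Application to the graph -/

namespace SimpleGraph

variable {V : Type*} [Fintype V] (G : SimpleGraph V) {u v w : V}

open Classical in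
theorem isSeparatedPath (huw : u ≠ w) (hnbr : G.neighborSet v = {u, w})
    (hN : G.closedNbhd u ∩ G.closedNbhd w = {v}) :
    IsSeparatedPath G.Adj u v w {i | G.Adj u i ∧ i ≠ v} {i | G.Adj w i ∧ i ≠ v} := by
  have hv : ∀ i, G.Adj v i ↔ i = u ∨ i = w := fun i => by
    rw [← mem_neighborSet, hnbr, Set.mem_insert_iff, Set.mem_singleton_iff]
  have hvu : G.Adj v u := (hv u).2 (.inl rfl)
  have hvw : G.Adj v w := (hv w).2 (.inr rfl)
  have hcap : ∀ i, (i = u ∨ G.Adj u i) → (i = w ∨ G.Adj w i) → i = v := fun i h₁ h₂ =>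
    hN.subset ⟨h₁, h₂⟩
  have hnuw : ¬ G.Adj u w := fun h => hvw.ne (hcap w (.inr h) (.inl rfl)).symm
  refine ⟨fun _ _ => Adj.symm, hvu.ne', huw, hvw.ne, fun i => ?_, hv, fun i => ?_, ?_, ?_, ?_⟩
  · by_cases hi : i = v <;> simp [hi, hvu.symm]
  · by_cases hi : i = v <;> simp [hi, hvw.symm]
  · rw [Finset.disjoint_left]
    intro i hi hi'
    simp only [Finset.mem_filter, Finset.mem_univ, true_and] at hi hi'
    exact hi.2 (hcap i (.inr hi.1) (.inr hi'.1))
  · simp [hnuw]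
  · simp [hnuw, G.adj_comm w u]

open Classical in
theorem removeAndSpan_adj (huw : u ≠ w) (hnbr : G.neighborSet v = {u, w})
    (hN : G.closedNbhd u ∩ G.closedNbhd w = {v}) (i j : ↥({u, v, w}ᶜ : Set V)) :
    (G.removeAndSpan u v w).Adj i j ↔
      spanRel G.Adj {i | G.Adj u i ∧ i ≠ v} {i | G.Adj w i ∧ i ≠ v} i j := by
  have hdisj := Finset.disjoint_left.1 (G.isSeparatedPath huw hnbr hN).disjoint
  obtain ⟨i, hi⟩ := i
  obtain ⟨j, hj⟩ := j
  simp only [Set.mem_compl_iff, Set.mem_insert_iff, Set.mem_singleton_iff, not_or] at hi hj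
  simp only [Finset.mem_filter, Finset.mem_univ, true_and] at hdisj
  -- `fromRel` discards loops; disjointness of A and B shows that none arise.
  have hne : G.Adj u i ∧ G.Adj w j → i ≠ j := by
    rintro ⟨h₁, h₂⟩ rfl
    exact hdisj ⟨h₁, hi.2.1⟩ ⟨h₂, hi.2.1⟩
  have hne' : G.Adj u j ∧ G.Adj w i → i ≠ j := by
    rintro ⟨h₁, h₂⟩ rfl
    exact hdisj ⟨h₁, hi.2.1⟩ ⟨h₂, hi.2.1⟩
  simp only [removeAndSpan, sup_adj, comap_adj, Function.Embedding.subtype_apply, fromRel_adj,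
    closedNbhd, Set.mem_insert_iff, mem_neighborSet, spanRel, Finset.mem_filter,
    Finset.mem_univ, true_and, ne_eq, Subtype.mk.injEq, hi, hj, false_or, not_false_eq_true,
    and_true]
  tauto

end SimpleGraph

theorem mainTheorem9 {V : Type*} [Fintype V] (G : SimpleGraph V) [DecidableRel G.Adj]
    (u v w : V) (hdeg : G.degree v = 2) (hnbr : G.neighborSet v = {u, w})
    (hN : G.closedNbhd u ∩ G.closedNbhd w = {v}) :
    Nonempty
      (G.indComplex.realization ≃ₕ
        UnreducedSuspension (G.removeAndSpan u v w).indComplex.realization) := by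
  classical
  -- If u = w, the neighbour set would have one element, against degree 2.
  have huw : u ≠ w := by
    rintro rfl
    rw [← G.card_neighborSet_eq_degree, ← Nat.card_eq_fintype_card, hnbr] at hdeg
    simp at hdeg
  obtain ⟨e⟩ := (G.isSeparatedPath huw hnbr hN).nonempty_homotopyEquiv
  obtain ⟨s⟩ := nonempty_unreducedSuspension_homeomorph (G.removeAndSpan_adj huw hnbr hN)
  rw [G.realization_indComplex, (G.removeAndSpan u v w).realization_indComplex]
  exact ⟨e.trans s.symm.toHomotopyEquiv⟩
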